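/- Let $K$ be a field, $\kappa\in K$, and let $(A,\mu,R,d)$ be a modified Rota-Baxter AssDer pair of weight $\kappa$: $A$ is a $K$-vector space with an associative (not necessarily unital) bilinear product $\mu(a,b)=ab$, $R:A\to A$ is linear with $R(a)R(b)=R(R(a)b+aR(b))+\kappa\,ab$, and $d$ is a derivation of $A$ with $Rd=dR$. Let $(M,l,r,R_M,d_M)$ be a bimodule over it: $(M,l,r)$ is an $A$-bimodule, and $R_M,d_M:M\to M$ are linear maps with $$l(R(a),R_M(m))=R_M\big(l(R(a),m)+l(a,R_M(m))\big)+\kappa\, l(a,m),\qquad r(R_M(m),R(a))=R_M\big(r(R_M(m),a)+r(m,R(a))\big)+\kappa\, r(m,a),$$ $$d_M(l(a,m))=l(d(a),m)+l(a,d_M(m)),\qquad d_M(r(m,a))=r(d_M(m),a)+r(m,d(a)),\qquad R_Md_M=d_MR_M .$$ **The associative complex.** Let $C^n(A;M)=\mathrm{Hom}(A^{\otimes n},M)$ with the Hochschild coboundary $$(\delta f)(a_1,\dots,a_{n+1})=(-1)^{n+1}l(a_1,f(a_2,\dots,a_{n+1}))+r(f(a_1,\dots,a_n),a_{n+1})+\sum_{i=1}^n(-1)^{i+n+1}f(a_1,\dots,a_ia_{i+1},\dots,a_{n+1}),$$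 let $\delta_R$ be given by the same formula for the induced product $\mu_R(a,b)=R(a)b+aR(b)$ and the induced actions $\tilde l(a,m)=l(R(a),m)-R_M(l(a,m))$, $\tilde r(m,a)=r(m,R(a))-R_M(r(m,a))$, and put $$\phi^n(f)(a_1,\dots,a_n)=\sum_{S\subseteq\{1,\dots,n\},\ |S|\text{ even}}(-\kappa)^{|S|/2}f(a^S)-\sum_{S\subseteq\{1,\dots,n\},\ |S|\text{ odd}}(-\kappa)^{(|S|-1)/2}R_M(f(a^S)),$$ where $a^S_i=a_i$ for $i\in S$ and $a^S_i=R(a_i)$ for $i\notin S$; put also $(\Delta^nf)(a_1,\dots,a_n)=\sum_i f(a_1,\dots,d(a_i),\dots,a_n)-d_M(f(a_1,\dots,a_n))$. Let $C^1_{\rm RB}=C^1(A;M)$ and $C^n_{\rm RB}=C^n(A;M)\oplus C^{n-1}(A;M)$ for $n\ge2$, with $\partial(f,g)=(\delta f,-\delta_Rg-\phi^n f)$ (for $n=1$: $\partial f=(\delta f,-\phi^1 f)$) and $\Delta(f,g)=(\Delta f,\Delta g)$. Let $\mathfrak C^1(A;M)=C^1(A;M)$ and $\mathfrak C^n(A;M)=C^n_{\rm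 RB}\times C^{n-1}_{\rm RB}$ for $n\ge 2$, with $$\mathfrak D^1(f)=(\partial f,-\Delta f),\qquad \mathfrak D^n(F,G)=(\partial F,\ \partial G+(-1)^n\Delta F)\quad(n\ge2).$$ **The Lie complex.** For a modified Rota-Baxter LieDer pair $(L,[\cdot,\cdot],R,d)$ of weight $\kappa$ (a Lie algebra with linear $R$ such that $[R(x),R(y)]=R([R(x),y]+[x,R(y)])+\kappa[x,y]$, and a derivation $d$ commuting with $R$) and a representation $(M,\rho,R_M,d_M)$ of it (a Lie algebra representation $\rho$ with $\rho(R(x))R_M(m)=R_M(\rho(R(x))m+\rho(x)R_M(m))+\kappa\rho(x)m$, $d_M(\rho(x)m)=\rho(d(x))m+\rho(x)d_M(m)$, $R_Md_M=d_MR_M$), the complex $(\mathfrak C^n(L;M),\mathfrak D^n)$ is defined by the same formulas with $C^n(A;M)$ replaced by $\mathrm{Hom}(\wedge^nL,M)$ and $\delta$ by the Chevalley-Eilenberg coboundary $$(\delta f)(x_1,\dots,x_{n+1})=\sum_{i}(-1)^{i+n}\rho(x_i)f(\dots,\hat x_i,\dots)+\sum_{i<j}(-1)^{i+j+n+1}f([x_i,x_j],\dots,\hat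 x_i,\dots,\hat x_j,\dots),$$ and $\delta_R$ by the same formula for the bracket $[x,y]_R=[R(x),y]+[x,R(y)]$ and the action $x\cdot m=\rho(R(x))m-R_M(\rho(x)m)$. In both cases $\mathcal H^n$ is the space of cocycles $\ker\mathfrak D^n$ modulo coboundaries (the image of $\mathfrak D^{n-1}$; zero for $n=1$). **Theorem.** Consider the modified Rota-Baxter LieDer pair $(A_C,R,d)$, where $A_C$ is $A$ with the commutator bracket $[a,b]_C=ab-ba$, and its representation $(M,\rho,R_M,d_M)$ with $\rho(a)m=l(a,m)-r(m,a)$. Let $S_n:\mathrm{Hom}(A^{\otimes n},M)\to\mathrm{Hom}(\wedge^nA,M)$ be the skew-symmetrization $(S_nf)(a_1,\dots,a_n)=\sum_{\sigma\in\mathbb S_n}\mathrm{sgn}(\sigma)f(a_{\sigma(1)},\dots,a_{\sigma(n)})$, and let $\mathcal S_n=(S_n,S_{n-1})$ and $\mathfrak S_n=(\mathcal S_n,\mathcal S_{n-1})$, where only the component $S_1$ is present in degree $1$. Then for all $n\ge1$ $$\mathfrak D^n\circ\mathfrak S_n=\mathfrak S_{n+1}\circ\mathfrak D^n ,$$ and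 consequently $\mathfrak S_n$ maps cocycles to cocycles and there is a unique linear map $\mathcal H^n(A;M)\to\mathcal H^n(A_C;M)$ with $[z]\mapsto[\mathfrak S_n z]$ for every $n$-cocycle $z$. -/

import Mathlib

namespace ModifiedRB

/-! ### Modified Rota-Baxter AssDer pairs, LieDer pairs, and their representations -/

/-- A modified Rota-Baxter AssDer pair of weight `κ` on the vector space `A`: an associative (not
necessarily unital) multiplication `mul`, a modified Rota-Baxter operator `R` of weight `κ`, and a
derivation `d` commuting with `R`. -/
structure AssDerPair {K : Type*} [Field K] (κ : K) (A : Type*) [AddCommGroup A] [Module K A] where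
  mul : A →ₗ[K] A →ₗ[K] A
  mul_assoc : ∀ a b c, mul (mul a b) c = mul a (mul b c)
  R : A →ₗ[K] A
  R_mul : ∀ a b, mul (R a) (R b) = R (mul (R a) b + mul a (R b)) + κ • mul a b
  d : A →ₗ[K] A
  d_mul : ∀ a b, d (mul a b) = mul (d a) b + mul a (d b)
  R_d : ∀ a, R (d a) = d (R a)

/-- A bimodule `(M, l, r, R_M, d_M)` over a modified Rota-Baxter AssDer pair. -/
structure AssBimodule {K : Type*} [Field K] {κ : K} {A : Type*} [AddCommGroup A] [Module K A]
    (P : AssDerPair κ A) (M : Type*) [AddCommGroup M] [Module K M] where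
  l : A →ₗ[K] M →ₗ[K] M
  r : M →ₗ[K] A →ₗ[K] M
  l_mul : ∀ a b m, l (P.mul a b) m = l a (l b m)
  l_r : ∀ a m b, l a (r m b) = r (l a m) b
  r_mul : ∀ m a b, r m (P.mul a b) = r (r m a) b
  RM : M →ₗ[K] M
  RM_l : ∀ a m, l (P.R a) (RM m) = RM (l (P.R a) m + l a (RM m)) + κ • l a m
  RM_r : ∀ m a, r (RM m) (P.R a) = RM (r (RM m) a + r m (P.R a)) + κ • r m a
  dM : M →ₗ[K] M
  dM_l : ∀ a m, dM (l a m) = l (P.d a) m + l a (dM m)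
  dM_r : ∀ m a, dM (r m a) = r (dM m) a + r m (P.d a)
  RM_dM : ∀ m, RM (dM m) = dM (RM m)

/-- A modified Rota-Baxter LieDer pair of weight `κ` on the vector space `L`: a Lie bracket,
a modified Rota-Baxter operator `R` of weight `κ`, and a derivation `d` commuting with `R`. -/
structure LieDerPair {K : Type*} [Field K] (κ : K) (L : Type*) [AddCommGroup L] [Module K L] where
  bracket : L →ₗ[K] L →ₗ[K] L
  bracket_self : ∀ x, bracket x x = 0
  jacobi : ∀ x y z, bracket x (bracket y z) = bracket (bracket x y) z + bracket y (bracket x z)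
  R : L →ₗ[K] L
  R_bracket : ∀ x y,
    bracket (R x) (R y) = R (bracket (R x) y + bracket x (R y)) + κ • bracket x y
  d : L →ₗ[K] L
  d_bracket : ∀ x y, d (bracket x y) = bracket (d x) y + bracket x (d y)
  R_d : ∀ x, R (d x) = d (R x)

/-- A representation `(M, ρ, R_M, d_M)` of a modified Rota-Baxter LieDer pair. -/
structure LieRep {K : Type*} [Field K] {κ : K} {L : Type*} [AddCommGroup L] [Module K L]
    (Q : LieDerPair κ L) (M : Type*) [AddCommGroup M] [Module K M] where
  ρ : L →ₗ[K] M →ₗ[K] M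
  ρ_bracket : ∀ x y m, ρ (Q.bracket x y) m = ρ x (ρ y m) - ρ y (ρ x m)
  RM : M →ₗ[K] M
  RM_ρ : ∀ x m, ρ (Q.R x) (RM m) = RM (ρ (Q.R x) m + ρ x (RM m)) + κ • ρ x m
  dM : M →ₗ[K] M
  dM_ρ : ∀ x m, dM (ρ x m) = ρ (Q.d x) m + ρ x (dM m)
  RM_dM : ∀ m, RM (dM m) = dM (RM m)

/-- The commutator modified Rota-Baxter LieDer pair `(A_C, R, d)`, `[a, b]_C = ab - ba`. -/
def AssDerPair.commutator {K : Type*} [Field K] {κ : K} {A : Type*} [AddCommGroup A] [Module K A]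
    (P : AssDerPair κ A) : LieDerPair κ A where
  bracket := P.mul - P.mul.flip
  bracket_self x := by simp
  jacobi x y z := by simp [P.mul_assoc]; abel
  R := P.R
  R_bracket x y := by simp [P.R_mul, smul_sub]; abel
  d := P.d
  d_bracket x y := by simp [P.d_mul]; abel
  R_d := P.R_d

/-- The representation `ρ(a) m = l(a, m) - r(m, a)` of `(A_C, R, d)` on `M`. -/
def AssBimodule.commutatorRep {K : Type*} [Field K] {κ : K} {A : Type*} [AddCommGroup A]
    [Module K A] {P : AssDerPair κ A} {M : Type*} [AddCommGroup M] [Module K M]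
    (N : AssBimodule P M) : LieRep P.commutator M where
  ρ := N.l - N.r.flip
  ρ_bracket x y m := by
    simp [AssDerPair.commutator, N.l_mul, N.r_mul, N.l_r]; abel
  RM := N.RM
  RM_ρ x m := by simp [AssDerPair.commutator, N.RM_l, N.RM_r, smul_sub]; abel
  dM := N.dM
  dM_ρ x m := by simp [AssDerPair.commutator, N.dM_l, N.dM_r]; abel
  RM_dM := N.RM_dM

/-! ### Hochschild cochains -/

section Hochschild

variable {K : Type*} [Field K] {A M : Type*} [AddCommGroup A] [Module K A] [AddCommGroup M]
  [Module K M]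

/-- Hochschild `n`-cochains `C^n(A; M) = Hom(A^{⊗ n}, M)`. -/
abbrev HochCochain (K : Type*) [Field K] (A M : Type*) [AddCommGroup A] [Module K A]
    [AddCommGroup M] [Module K M] (n : ℕ) :=
  MultilinearMap K (fun _ : Fin n => A) M

theorem contractNth_update (mul : A →ₗ[K] A →ₗ[K] A) {n : ℕ} (i : Fin n) (v : Fin (n + 1) → A)
    (p : Fin (n + 1)) : ∃ (k : Fin n) (T : A →ₗ[K] A), ∀ x,
      Fin.contractNth i.castSucc (fun a b => mul a b) (Function.update v p x) =
        Function.update (Fin.contractNth i.castSucc (fun a b => mul a b) v) k (T x) := by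
  rcases lt_trichotomy (p : ℕ) i with h | h | h
  · refine ⟨⟨p, by omega⟩, LinearMap.id, fun x => ?_⟩
    ext k
    by_cases hk : k = ⟨p, by omega⟩
    · subst hk
      simp [Fin.contractNth, h]
    · have : (k : ℕ) ≠ p := fun e => hk (Fin.ext e)
      rw [Function.update_of_ne hk]
      simp only [Fin.contractNth, Fin.val_castSucc]
      split_ifs with h1 h2
      · rw [Function.update_of_ne]; intro e; simp [Fin.ext_iff] at e; omega
      · rw [Function.update_of_ne, Function.update_of_ne] <;>
          (intro e; simp [Fin.ext_iff] at e; omega)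
      · rw [Function.update_of_ne]; intro e; simp [Fin.ext_iff] at e; omega
  · refine ⟨i, mul.flip (v i.succ), fun x => ?_⟩
    have hp : p = i.castSucc := Fin.ext h
    subst hp
    ext k
    by_cases hk : k = i
    · subst hk
      have : k.succ ≠ k.castSucc := by simp [Fin.ext_iff]
      simp [Fin.contractNth, this]
    · have : (k : ℕ) ≠ i := fun e => hk (Fin.ext e)
      rw [Function.update_of_ne hk]
      simp only [Fin.contractNth, Fin.val_castSucc]
      split_ifs with h1
      · rw [Function.update_of_ne]; intro e; simp [Fin.ext_iff] at e; omega
      · rw [Function.update_of_ne]; intro e; simp [Fin.ext_iff] at e; omega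
  · obtain ⟨q, rfl⟩ : ∃ q : Fin n, p = q.succ :=
      ⟨p.pred (by rintro rfl; simp at h), by simp⟩
    simp only [Fin.val_succ] at h
    by_cases hq : q = i
    · subst hq
      refine ⟨q, mul (v q.castSucc), fun x => ?_⟩
      ext k
      by_cases hk : k = q
      · subst hk
        have : k.castSucc ≠ k.succ := by simp [Fin.ext_iff]
        simp [Fin.contractNth, this]
      · have : (k : ℕ) ≠ q := fun e => hk (Fin.ext e)
        rw [Function.update_of_ne hk]
        simp only [Fin.contractNth, Fin.val_castSucc]
        split_ifs with h1
        · rw [Function.update_of_ne]; intro e; simp [Fin.ext_iff] at e; omega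
        · rw [Function.update_of_ne]; intro e; simp [Fin.ext_iff] at e; omega
    · have hqi : (q : ℕ) ≠ i := fun e => hq (Fin.ext e)
      refine ⟨q, LinearMap.id, fun x => ?_⟩
      ext k
      by_cases hk : k = q
      · subst hk
        have h1 : ¬ (k : ℕ) < i := by omega
        simp [Fin.contractNth, h1, hqi]
      · have : (k : ℕ) ≠ q := fun e => hk (Fin.ext e)
        rw [Function.update_of_ne hk]
        simp only [Fin.contractNth, Fin.val_castSucc]
        split_ifs with h1 h2
        · rw [Function.update_of_ne]; intro e; simp [Fin.ext_iff] at e; omega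
        · rw [Function.update_of_ne, Function.update_of_ne] <;>
            (intro e; simp [Fin.ext_iff] at e; omega)
        · rw [Function.update_of_ne]; intro e; simp [Fin.ext_iff] at e; omega

/-- The multilinear map `(a_1, …, a_{n+1}) ↦ l(a_1, f(a_2, …, a_{n+1}))`. -/
def leftTerm (l : A →ₗ[K] M →ₗ[K] M) {n : ℕ} (f : HochCochain K A M n) :
    HochCochain K A M (n + 1) :=
  MultilinearMap.mk' (fun v => l (v 0) (f (Fin.tail v)))
    (fun v p x y => by
      refine Fin.cases ?_ (fun p => ?_) p
      · simp [Fin.tail_update_zero]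
      · have : (0 : Fin (n + 1)) ≠ p.succ := (Fin.succ_ne_zero p).symm
        simp [Fin.tail_update_succ, this])
    (fun v p c x => by
      refine Fin.cases ?_ (fun p => ?_) p
      · simp [Fin.tail_update_zero]
      · have : (0 : Fin (n + 1)) ≠ p.succ := (Fin.succ_ne_zero p).symm
        simp [Fin.tail_update_succ, this])

/-- The multilinear map `(a_1, …, a_{n+1}) ↦ r(f(a_1, …, a_n), a_{n+1})`. -/
def rightTerm (r : M →ₗ[K] A →ₗ[K] M) {n : ℕ} (f : HochCochain K A M n) :
    HochCochain K A M (n + 1) :=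
  MultilinearMap.mk' (fun v => r (f (Fin.init v)) (v (Fin.last n)))
    (fun v p x y => by
      refine Fin.lastCases ?_ (fun p => ?_) p
      · simp [Fin.init_update_last]
      · have : Fin.last n ≠ p.castSucc := (Fin.castSucc_lt_last p).ne'
        simp [Fin.init_update_castSucc, this])
    (fun v p c x => by
      refine Fin.lastCases ?_ (fun p => ?_) p
      · simp [Fin.init_update_last]
      · have : Fin.last n ≠ p.castSucc := (Fin.castSucc_lt_last p).ne'
        simp [Fin.init_update_castSucc, this])

/-- The multilinear map `(a_1, …, a_{n+1}) ↦ f(a_1, …, a_{i+1} a_{i+2}, …, a_{n+1})`,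
for `i = 0, …, n - 1`. -/
def contractTerm (mul : A →ₗ[K] A →ₗ[K] A) {n : ℕ} (i : Fin n) (f : HochCochain K A M n) :
    HochCochain K A M (n + 1) :=
  MultilinearMap.mk' (fun v => f (Fin.contractNth i.castSucc (fun a b => mul a b) v))
    (fun v p x y => by
      obtain ⟨k, T, h⟩ := contractNth_update mul i v p
      simp [h])
    (fun v p c x => by
      obtain ⟨k, T, h⟩ := contractNth_update mul i v p
      simp [h])

/-- The Hochschild coboundary for a multiplication `mul` on `A` and actions `l`, `r` on `M`:
`(δ f)(a_1, …, a_{n+1}) = (-1)^{n+1} l(a_1, f(a_2, …, a_{n+1})) + r(f(a_1, …, a_n), a_{n+1})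
  + ∑_{i=1}^n (-1)^{i+n+1} f(a_1, …, a_i a_{i+1}, …, a_{n+1})`. -/
def hochD (mul : A →ₗ[K] A →ₗ[K] A) (l : A →ₗ[K] M →ₗ[K] M) (r : M →ₗ[K] A →ₗ[K] M) (n : ℕ) :
    HochCochain K A M n →ₗ[K] HochCochain K A M (n + 1) where
  toFun f := (-1 : K) ^ (n + 1) • leftTerm l f + rightTerm r f +
    ∑ i : Fin n, (-1 : K) ^ ((i : ℕ) + 1 + n + 1) • contractTerm mul i f
  map_add' f g := by
    ext v
    simp [leftTerm, rightTerm, contractTerm, Finset.sum_add_distrib]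
    abel
  map_smul' c f := by
    ext v
    simp [leftTerm, rightTerm, contractTerm, Finset.smul_sum, smul_comm c]

/-- The operator that `φ` applies to a term in which `r` arguments are left alone:
`(-κ)^{r/2}` for `r` even, and `-(-κ)^{(r-1)/2} R_M` for `r` odd. -/
def phiCoeff (κ : K) (RM : M →ₗ[K] M) (r : ℕ) : M →ₗ[K] M :=
  if Even r then (-κ) ^ (r / 2) • LinearMap.id else -((-κ) ^ ((r - 1) / 2) • RM)

/-- The map `φ^n`: the sum over all subsets `s` of the set of argument positions of `f` evaluated
with the arguments in `s` left alone and `R` applied to the other ones, with the coefficient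
`phiCoeff` for `r = |s|`. -/
def phiHoch (κ : K) (R : A →ₗ[K] A) (RM : M →ₗ[K] M) (n : ℕ) :
    HochCochain K A M n →ₗ[K] HochCochain K A M n where
  toFun f := ∑ s : Finset (Fin n), (phiCoeff κ RM s.card).compMultilinearMap
    (f.compLinearMap (fun i => if i ∈ s then LinearMap.id else R))
  map_add' f g := by
    ext v
    simp [Finset.sum_add_distrib]
  map_smul' c f := by
    ext v
    simp [Finset.smul_sum]

theorem phiHoch_apply (κ : K) (R : A →ₗ[K] A) (RM : M →ₗ[K] M) (n : ℕ)
    (f : HochCochain K A M n) (v : Fin n → A) :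
    phiHoch κ R RM n f v = ∑ s : Finset (Fin n),
      phiCoeff κ RM s.card (f (fun i => if i ∈ s then v i else R (v i))) := by
  simp only [phiHoch, LinearMap.coe_mk, AddHom.coe_mk, sum_apply,
    LinearMap.compMultilinearMap_apply, MultilinearMap.compLinearMap_apply]
  refine Finset.sum_congr rfl fun s _ => ?_
  congr 2
  ext i
  split_ifs <;> rfl

/-- `(Δ^n f)(a_1, …, a_n) = ∑_i f(a_1, …, d a_i, …, a_n) - d_M (f(a_1, …, a_n))`. -/
def deltaHoch (d : A →ₗ[K] A) (dM : M →ₗ[K] M) (n : ℕ) :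
    HochCochain K A M n →ₗ[K] HochCochain K A M n where
  toFun f := ∑ i : Fin n, f.compLinearMap (Function.update (fun _ => LinearMap.id) i d) -
    dM.compMultilinearMap f
  map_add' f g := by
    ext v
    simp [Finset.sum_add_distrib]
    abel
  map_smul' c f := by
    ext v
    simp [Finset.smul_sum, smul_sub]

theorem deltaHoch_apply (d : A →ₗ[K] A) (dM : M →ₗ[K] M) (n : ℕ)
    (f : HochCochain K A M n) (v : Fin n → A) :
    deltaHoch d dM n f v = ∑ i : Fin n, f (Function.update v i (d (v i))) - dM (f v) := by
  simp only [deltaHoch, LinearMap.coe_mk, AddHom.coe_mk, sub_apply,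
    sum_apply, LinearMap.compMultilinearMap_apply,
    MultilinearMap.compLinearMap_apply]
  congr 1
  refine Finset.sum_congr rfl fun i _ => ?_
  congr 1
  ext k
  by_cases hk : k = i
  · subst hk; simp
  · simp [hk]

end Hochschild

/-! ### Chevalley-Eilenberg cochains -/

section ChevalleyEilenberg

variable {K : Type*} [Field K] {L M : Type*} [AddCommGroup L] [Module K L] [AddCommGroup M]
  [Module K M]

/-- Chevalley-Eilenberg `n`-cochains `Hom(⋀^n L, M)`. -/
abbrev CECochain (K : Type*) [Field K] (L M : Type*) [AddCommGroup L] [Module K L]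
    [AddCommGroup M] [Module K M] (n : ℕ) :=
  L [⋀^Fin n]→ₗ[K] M

/-- The linear map `x ↦ ρ(x) ∘ f` with values in alternating maps. -/
def actCurry (ρ : L →ₗ[K] M →ₗ[K] M) {n : ℕ} (f : CECochain K L M n) :
    L →ₗ[K] CECochain K L M n where
  toFun x := (ρ x).compAlternatingMap f
  map_add' x y := by ext v; simp
  map_smul' c x := by ext v; simp

/-- The arguments `([x_i, x_j], x_1, …, x̂_i, …, x̂_j, …, x_{n+2})`, the two entries being
those at the (zero-based) positions `i` and `j + 1`, where `i ≤ j`. -/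
def bracketArgs (br : L →ₗ[K] L →ₗ[K] L) {n : ℕ} (i j : Fin (n + 1)) (v : Fin (n + 2) → L) :
    Fin (n + 1) → L :=
  Fin.cons (br (v i.castSucc) (v j.succ)) (Fin.removeNth j (Fin.removeNth i.castSucc v))


theorem bracketArgs_update (br : L →ₗ[K] L →ₗ[K] L) {n : ℕ} {i j : Fin (n + 1)} (hij : i ≤ j)
    (v : Fin (n + 2) → L) (p : Fin (n + 2)) : ∃ (k : Fin (n + 1)) (T : L →ₗ[K] L), ∀ x,
      bracketArgs br i j (Function.update v p x) =
        Function.update (bracketArgs br i j v) k (T x) := by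
  have hne : j.succ ≠ i.castSucc := by
    intro e; have := congrArg Fin.val e; simp at this; have : (i : ℕ) ≤ j := hij; omega
  have hs : i.castSucc.succAbove j = j.succ := Fin.succAbove_of_le_castSucc _ _ (by simpa using hij)
  by_cases h1 : p = i.castSucc
  · subst h1
    refine ⟨0, br.flip (v j.succ), fun x => ?_⟩
    simp [bracketArgs, hne, Fin.removeNth_update]
  · obtain ⟨q, rfl⟩ := Fin.exists_succAbove_eq h1
    by_cases h2 : q = j
    · subst h2
      refine ⟨0, br (v i.castSucc), fun x => ?_⟩
      have : Fin.removeNth q (Fin.removeNth i.castSucc (Function.update v q.succ x)) =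
          Fin.removeNth q (Fin.removeNth i.castSucc v) := by
        rw [← hs]
        ext k
        simp [Fin.removeNth]
      simp [bracketArgs, hs, hne.symm, this]
    · obtain ⟨s, rfl⟩ := Fin.exists_succAbove_eq h2
      refine ⟨s.succ, LinearMap.id, fun x => ?_⟩
      have h3 : j.succ ≠ i.castSucc.succAbove (j.succAbove s) := by
        rw [← hs]; intro e; exact h2 (Fin.succAbove_right_injective e).symm
      simp [bracketArgs, h3, Ne.symm h1, Fin.cons_update]

/-- The multilinear map `v ↦ ∑_{i ≤ j} (-1)^{i+j} f([v_i, v_{j+1}], …, v̂_i, …, v̂_{j+1}, …)`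
(zero-based positions). -/
def bracketSum (br : L →ₗ[K] L →ₗ[K] L) {n : ℕ} (f : CECochain K L M (n + 1)) :
    MultilinearMap K (fun _ : Fin (n + 2) => L) M :=
  MultilinearMap.mk'
    (fun v => ∑ i : Fin (n + 1), ∑ j : Fin (n + 1),
      if i ≤ j then (-1 : K) ^ ((i : ℕ) + j) • f (bracketArgs br i j v) else 0)
    (fun v p x y => by
      simp only [← Finset.sum_add_distrib]
      refine Finset.sum_congr rfl fun i _ => Finset.sum_congr rfl fun j _ => ?_
      split_ifs with hij
      · obtain ⟨k, T, h⟩ := bracketArgs_update br hij v p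
        simp [h]
      · simp)
    (fun v p c x => by
      simp only [Finset.smul_sum]
      refine Finset.sum_congr rfl fun i _ => Finset.sum_congr rfl fun j _ => ?_
      split_ifs with hij
      · obtain ⟨k, T, h⟩ := bracketArgs_update br hij v p
        simp [h, smul_comm c]
      · simp)

theorem bracketSum_apply (br : L →ₗ[K] L →ₗ[K] L) {n : ℕ} (f : CECochain K L M (n + 1))
    (v : Fin (n + 2) → L) :
    bracketSum br f v = ∑ i : Fin (n + 1), ∑ j : Fin (n + 1),
      if i ≤ j then (-1 : K) ^ ((i : ℕ) + j) • f (bracketArgs br i j v) else 0 := rfl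

theorem bracketSum_two (br : L →ₗ[K] L →ₗ[K] L) (f : CECochain K L M 1) (v : Fin 2 → L) :
    bracketSum br f v = f (fun _ => br (v 0) (v 1)) := by
  rw [bracketSum_apply]
  simp [bracketArgs]
  congr 1
  ext k
  fin_cases k
  rfl

theorem bracketSum_cons (br : L →ₗ[K] L →ₗ[K] L) {n : ℕ} (f : CECochain K L M (n + 2)) (x : L)
    (w : Fin (n + 2) → L) :
    bracketSum br f (Fin.cons x w) =
      AlternatingMap.alternatizeUncurryFin (f.curryLeft ∘ₗ br x) w -
        bracketSum br (f.curryLeft x) w := by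
  rw [bracketSum_apply, Fin.sum_univ_succ, sub_eq_add_neg]
  congr 1
  · rw [AlternatingMap.alternatizeUncurryFin_apply]
    refine Finset.sum_congr rfl fun j _ => ?_
    have : bracketArgs br 0 j (Fin.cons x w : Fin (n + 3) → L) =
        Matrix.vecCons (br x (w j)) (Fin.removeNth j w) := by
      ext k
      refine Fin.cases ?_ (fun k => ?_) k
      · simp [bracketArgs]
      · simp [bracketArgs, Fin.removeNth]
    simp [this, ← Int.cast_smul_eq_zsmul K]
  · rw [bracketSum_apply, ← Finset.sum_neg_distrib]
    refine Finset.sum_congr rfl fun i _ => ?_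
    rw [Fin.sum_univ_succ, ← Finset.sum_neg_distrib]
    rw [if_neg (by simp), zero_add]
    simp only [Fin.succ_le_succ_iff]
    refine Finset.sum_congr rfl fun j _ => ?_
    split_ifs with hij
    · set y := bracketArgs br i j w with hy
      have e : bracketArgs br i.succ j.succ (Fin.cons x w : Fin (n + 3) → L) =
          (Matrix.vecCons x y) ∘ Equiv.swap 0 1 := by
        ext k
        refine Fin.cases ?_ (fun k => ?_) k
        · simp [bracketArgs, hy]
        · refine Fin.cases ?_ (fun k => ?_) k
          · simp [bracketArgs, Fin.removeNth]
          · have : Equiv.swap (0 : Fin (n + 2)) 1 k.succ.succ = k.succ.succ := by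
              refine Equiv.swap_apply_of_ne_of_ne ?_ ?_ <;> simp [Fin.ext_iff]
            simp [bracketArgs, hy, Fin.removeNth, this]
      rw [e, AlternatingMap.map_swap _ _ (by simp), AlternatingMap.curryLeft_apply_apply]
      simp only [Fin.val_succ, smul_neg]
      congr 2
      ring
    · simp

theorem alternatizeUncurryFin_cons_self (br : L →ₗ[K] L →ₗ[K] L) (hbr : ∀ x, br x x = 0) {n : ℕ}
    (f : CECochain K L M (n + 2)) (x : L) (u : Fin (n + 1) → L) :
    AlternatingMap.alternatizeUncurryFin (f.curryLeft ∘ₗ br x) (Fin.cons x u) =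
      AlternatingMap.alternatizeUncurryFin ((f.curryLeft x).curryLeft ∘ₗ br x) u := by
  rw [AlternatingMap.alternatizeUncurryFin_apply, AlternatingMap.alternatizeUncurryFin_apply,
    Fin.sum_univ_succ]
  simp only [Fin.cons_zero, LinearMap.comp_apply, hbr, map_zero, AlternatingMap.zero_apply,
    smul_zero, zero_add, Fin.cons_succ]
  refine Finset.sum_congr rfl fun j _ => ?_
  simp only [AlternatingMap.curryLeft_apply_apply]
  have e : Matrix.vecCons (br x (u j)) (Fin.removeNth j.succ (Fin.cons x u : Fin (n + 2) → L)) =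
      Matrix.vecCons x (Matrix.vecCons (br x (u j)) (Fin.removeNth j u)) ∘ Equiv.swap 0 1 := by
    ext k
    refine Fin.cases ?_ (fun k => ?_) k
    · simp
    · refine Fin.cases ?_ (fun k => ?_) k
      · simp [Fin.removeNth]
      · have : Equiv.swap (0 : Fin (n + 2)) 1 k.succ.succ = k.succ.succ := by
          refine Equiv.swap_apply_of_ne_of_ne ?_ ?_ <;> simp [Fin.ext_iff]
        simp [Fin.removeNth, this]
  rw [e, AlternatingMap.map_swap _ _ (by simp)]
  simp [pow_succ]

theorem bracketSum_cons_cons (br : L →ₗ[K] L →ₗ[K] L) (hbr : ∀ x, br x x = 0) :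
    ∀ {n : ℕ} (f : CECochain K L M (n + 1)) (x : L) (u : Fin n → L),
      bracketSum br f (Fin.cons x (Fin.cons x u : Fin (n + 1) → L)) = 0
  | 0, f, x, u => by
    rw [bracketSum_two]
    exact f.map_coord_zero 0 (by simp [hbr])
  | 1, f, x, u => by
    rw [bracketSum_cons, alternatizeUncurryFin_cons_self br hbr, bracketSum_two,
      AlternatingMap.alternatizeUncurryFin_apply, sub_eq_zero]
    rw [Fin.sum_univ_succ]
    have e : (Matrix.vecCons x (Matrix.vecCons (br x (u 0)) (Fin.removeNth (0 : Fin 1) u)) :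
        Fin 2 → L) = Matrix.vecCons x (fun _ => br x (u 0)) := by
      ext k; fin_cases k <;> rfl
    simpa [-Fin.removeNth_zero, AlternatingMap.curryLeft_apply_apply] using congrArg f e
  | n + 2, f, x, u => by
    rw [bracketSum_cons, alternatizeUncurryFin_cons_self br hbr, bracketSum_cons]
    have : (f.curryLeft x).curryLeft x = 0 := AlternatingMap.curryLeft_same f x
    simp [this, bracketSum_apply]

theorem bracketSum_eq_zero (br : L →ₗ[K] L →ₗ[K] L) (hbr : ∀ x, br x x = 0) :
    ∀ {n : ℕ} (f : CECochain K L M (n + 1)) (v : Fin (n + 2) → L) (i j : Fin (n + 2)),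
      v i = v j → i ≠ j → bracketSum br f v = 0 := by
  intro n
  induction n with
  | zero =>
    intro f v i j hv hij
    have h : v 0 = v 1 := by fin_cases i <;> fin_cases j <;> simp_all
    rw [bracketSum_two]
    exact f.map_coord_zero 0 (by simp [hbr, h])
  | succ n ih =>
    intro f v i j hv hij
    -- for a fixed first argument the sum is alternating in the remaining ones
    let G : L → L [⋀^Fin (n + 2)]→ₗ[K] M := fun x =>
      AlternatingMap.alternatizeUncurryFin (f.curryLeft ∘ₗ br x) -
        { bracketSum br (f.curryLeft x) with
          map_eq_zero_of_eq' := fun w a b hw hab => ih (f.curryLeft x) w a b hw hab }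
    have hG : ∀ x w, bracketSum br f (Fin.cons x w) = G x w := fun x w => bracketSum_cons br f x w
    have key : ∀ (x : L) (w : Fin (n + 2) → L) (b : Fin (n + 2)), w b = x → G x w = 0 := by
      intro x w b hb
      have h0 : ∀ w' : Fin (n + 2) → L, w' 0 = x → G x w' = 0 := by
        intro w' hw'
        rw [← hG]
        have := bracketSum_cons_cons br hbr f x (Fin.tail w')
        rwa [← hw', Fin.cons_self_tail, hw'] at this
      by_cases hb0 : b = 0
      · exact h0 w (hb0 ▸ hb)
      · have h1 : G x (w ∘ Equiv.swap 0 b) = 0 := h0 _ (by simp [hb])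
        rw [AlternatingMap.map_swap _ _ (Ne.symm hb0), neg_eq_zero] at h1
        exact h1
    rw [← Fin.cons_self_tail v, hG]
    revert hv hij
    refine Fin.cases ?_ (fun i => ?_) i <;> refine Fin.cases ?_ (fun j => ?_) j
    · intro _ h; exact absurd rfl h
    · intro hv _; exact key _ _ j hv.symm
    · intro hv _; exact key _ _ i hv
    · intro hv h
      exact (G (v 0)).map_eq_zero_of_eq _ hv (fun e => h (congrArg Fin.succ e))

/-- The second half of the Chevalley-Eilenberg coboundary as an alternating map. -/
def bracketTerm (br : L →ₗ[K] L →ₗ[K] L) (hbr : ∀ x, br x x = 0) {n : ℕ}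
    (f : CECochain K L M (n + 1)) : CECochain K L M (n + 2) :=
  { bracketSum br f with
    map_eq_zero_of_eq' := fun v i j hv hij => bracketSum_eq_zero br hbr f v i j hv hij }

theorem bracketTerm_apply (br : L →ₗ[K] L →ₗ[K] L) (hbr : ∀ x, br x x = 0) {n : ℕ}
    (f : CECochain K L M (n + 1)) (v : Fin (n + 2) → L) :
    bracketTerm br hbr f v = ∑ i : Fin (n + 1), ∑ j : Fin (n + 1),
      if i ≤ j then (-1 : K) ^ ((i : ℕ) + j) • f (bracketArgs br i j v) else 0 := rfl

/-- The Chevalley-Eilenberg coboundary on `m`-cochains, `m = n + 1 ≥ 1`, for a bracket `br` on `L`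
and an action `ρ` on `M`, with the sign convention matching the one of `hochD`:
`(δ f)(x_1, …, x_{m+1}) = ∑_i (-1)^{i+m} ρ(x_i) f(x_1, …, x̂_i, …, x_{m+1})
  + ∑_{i<j} (-1)^{i+j+m+1} f([x_i, x_j], x_1, …, x̂_i, …, x̂_j, …, x_{m+1})`. -/
def ceD (br : L →ₗ[K] L →ₗ[K] L) (hbr : ∀ x, br x x = 0) (ρ : L →ₗ[K] M →ₗ[K] M) (n : ℕ) :
    CECochain K L M (n + 1) →ₗ[K] CECochain K L M (n + 2) where
  toFun f := (-1 : K) ^ n •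
    (AlternatingMap.alternatizeUncurryFin (actCurry ρ f) - bracketTerm br hbr f)
  map_add' f g := by
    ext v
    have : ∀ i j : Fin (n + 1), ∀ a b : M,
        (if i ≤ j then a + b else 0) = (if i ≤ j then a else 0) + (if i ≤ j then b else 0) := by
      intro i j a b; split_ifs <;> simp
    simp only [AlternatingMap.smul_apply, AlternatingMap.sub_apply, AlternatingMap.add_apply,
      AlternatingMap.alternatizeUncurryFin_apply, bracketTerm_apply, actCurry, LinearMap.coe_mk,
      AddHom.coe_mk, LinearMap.compAlternatingMap_apply, map_add, smul_add, this,
      Finset.sum_add_distrib, smul_sub]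
    abel
  map_smul' c f := by
    ext v
    simp only [RingHom.id_apply, AlternatingMap.smul_apply, AlternatingMap.sub_apply,
      AlternatingMap.alternatizeUncurryFin_apply, bracketTerm_apply, actCurry, LinearMap.coe_mk,
      AddHom.coe_mk, LinearMap.compAlternatingMap_apply, map_smul, smul_sub, Finset.smul_sum,
      smul_ite, smul_zero]
    simp only [smul_comm c]

/-- The coboundary formula with explicit signs, positions `i, j` being zero-based. -/
theorem ceD_apply (br : L →ₗ[K] L →ₗ[K] L) (hbr : ∀ x, br x x = 0) (ρ : L →ₗ[K] M →ₗ[K] M) (n : ℕ)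
    (f : CECochain K L M (n + 1)) (v : Fin (n + 2) → L) :
    ceD br hbr ρ n f v =
      (∑ i : Fin (n + 2), (-1 : K) ^ ((i : ℕ) + 1 + (n + 1)) • ρ (v i) (f (i.removeNth v))) +
      ∑ i : Fin (n + 1), ∑ j : Fin (n + 1), if i ≤ j then
        (-1 : K) ^ (((i : ℕ) + 1) + ((j : ℕ) + 2) + (n + 1) + 1) • f (bracketArgs br i j v)
      else 0 := by
  have h : ceD br hbr ρ n f v = (-1 : K) ^ n •
    (AlternatingMap.alternatizeUncurryFin (actCurry ρ f) v - bracketTerm br hbr f v) := rfl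
  rw [h, AlternatingMap.alternatizeUncurryFin_apply, bracketTerm_apply, smul_sub, sub_eq_add_neg,
    Finset.smul_sum, Finset.smul_sum, ← Finset.sum_neg_distrib]
  congr 1
  · refine Finset.sum_congr rfl fun i _ => ?_
    rw [← Int.cast_smul_eq_zsmul K, smul_smul]
    simp [actCurry, pow_add, mul_comm]
  · refine Finset.sum_congr rfl fun i _ => ?_
    rw [Finset.smul_sum, ← Finset.sum_neg_distrib]
    refine Finset.sum_congr rfl fun j _ => ?_
    split_ifs
    · rw [smul_smul, ← neg_smul]
      congr 1
      ring
    · simp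

/-- A signed cancellation: if an involution `e` of the index set of a sum corresponds to swapping
two arguments of an alternating map, then the sum vanishes. -/
theorem sum_alternating_eq_zero {n : ℕ} {α : Type*} [Fintype α] (f : CECochain K L M n)
    (c : α → Module.End K M) (g : α → Fin n → L) (e : α → α) (he : ∀ s, e (e s) = s)
    {a b : Fin n} (hab : a ≠ b) (hc : ∀ s, c (e s) = c s)
    (hg : ∀ s, g (e s) = g s ∘ Equiv.swap a b) : ∑ s, c s (f (g s)) = 0 := by
  classical
  refine Finset.sum_involution (fun s _ => e s) ?_ ?_ (fun _ _ => Finset.mem_univ _)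
    (fun s _ => he s)
  · intro s _
    rw [hc, hg, AlternatingMap.map_swap _ _ hab, map_neg, add_neg_cancel]
  · intro s _ hs heq
    apply hs
    have h1 : g s a = g s b := by
      have := congrFun (hg s) b
      rw [heq] at this
      simpa using this.symm
    rw [f.map_eq_zero_of_eq _ h1 hab, map_zero]

/-- The map `φ^n` on Chevalley-Eilenberg cochains, given by the same formula as `phiHoch`. -/
def phiCE (κ : K) (R : L →ₗ[K] L) (RM : M →ₗ[K] M) (n : ℕ) :
    CECochain K L M n →ₗ[K] CECochain K L M n where
  toFun f :=
    { phiHoch κ R RM n f.toMultilinearMap with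
      map_eq_zero_of_eq' := fun v a b hv hab => by
        have e : phiHoch κ R RM n f.toMultilinearMap v = ∑ s : Finset (Fin n),
            phiCoeff κ RM s.card (f (fun i => if i ∈ s then v i else R (v i))) := by
          simp only [phiHoch_apply, AlternatingMap.coe_multilinearMap]
        refine e.trans (sum_alternating_eq_zero f
          (fun s : Finset (Fin n) => phiCoeff κ RM s.card)
          (fun s i => if i ∈ s then v i else R (v i))
          (fun s => s.map (Equiv.swap a b).toEmbedding) (fun s => ?_) hab (fun s => ?_)
          (fun s => ?_))
        · ext i; simp [Finset.mem_map_equiv]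
        · simp
        · have hv' : ∀ i, v (Equiv.swap a b i) = v i := fun i => by
            rw [Equiv.apply_swap_eq_self hv]
          ext i
          simp [Finset.mem_map_equiv, hv'] }
  map_add' f g := by
    ext v
    exact DFunLike.congr_fun (map_add (phiHoch κ R RM n) f.toMultilinearMap g.toMultilinearMap) v
  map_smul' c f := by
    ext v
    exact DFunLike.congr_fun (map_smul (phiHoch κ R RM n) c f.toMultilinearMap) v

/-- The map `Δ^n` on Chevalley-Eilenberg cochains, given by the same formula as `deltaHoch`. -/
def deltaCE (d : L →ₗ[K] L) (dM : M →ₗ[K] M) (n : ℕ) :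
    CECochain K L M n →ₗ[K] CECochain K L M n where
  toFun f :=
    { deltaHoch d dM n f.toMultilinearMap with
      map_eq_zero_of_eq' := fun v a b hv hab => by
        have e : deltaHoch d dM n f.toMultilinearMap v =
            (∑ i, (LinearMap.id : Module.End K M) (f (Function.update v i (d (v i))))) -
              dM (f v) := by
          simp only [deltaHoch_apply, AlternatingMap.coe_multilinearMap, LinearMap.id_apply]
        have e2 : (∑ i, (LinearMap.id : Module.End K M) (f (Function.update v i (d (v i))))) = 0 :=
          sum_alternating_eq_zero f (fun _ => LinearMap.id)
            (fun i => Function.update v i (d (v i))) (Equiv.swap a b) (fun i => by simp) hab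
            (fun _ => rfl) (fun i => by
              have hv' : ∀ i, v (Equiv.swap a b i) = v i := fun i => by
                rw [Equiv.apply_swap_eq_self hv]
              ext k
              simp only [Function.comp_apply, Function.update_apply, hv',
                Equiv.swap_apply_eq_iff])
        refine e.trans ?_
        rw [e2, f.map_eq_zero_of_eq v hv hab, map_zero, sub_zero] }
  map_add' f g := by
    ext v
    exact DFunLike.congr_fun (map_add (deltaHoch d dM n) f.toMultilinearMap g.toMultilinearMap) v
  map_smul' c f := by
    ext v
    exact DFunLike.congr_fun (map_smul (deltaHoch d dM n) c f.toMultilinearMap) v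

/-- The skew-symmetrization map
`(S_n f)(a_1, …, a_n) = ∑_{σ ∈ S_n} sgn(σ) f(a_{σ(1)}, …, a_{σ(n)})`. -/
def skew (n : ℕ) : HochCochain K L M n →ₗ[K] CECochain K L M n where
  toFun f := MultilinearMap.alternatization f
  map_add' f g := map_add _ f g
  map_smul' c f := by
    ext v
    simp [MultilinearMap.alternatization_apply, Finset.smul_sum, smul_comm c]

theorem skew_apply (n : ℕ) (f : HochCochain K L M n) (v : Fin n → L) :
    skew n f v = ∑ σ : Equiv.Perm (Fin n), Equiv.Perm.sign σ • f (fun i => v (σ i)) := by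
  simp [skew, MultilinearMap.alternatization_apply]

end ChevalleyEilenberg

/-! ### The complexes -/

section Pairs

universe w

/-- From a graded space `C` form the graded space with `C 1` in degree `1`, with
`C n × C (n - 1)` in degree `n ≥ 2`, and with the zero space in degree `0`. -/
def PairCochain (C : ℕ → Type w) : ℕ → Type w
  | 0 => PUnit.{w + 1}
  | 1 => C 1
  | n + 2 => C (n + 2) × C (n + 1)

instance PairCochain.instAddCommGroup (C : ℕ → Type w) [∀ n, AddCommGroup (C n)] :
    ∀ n, AddCommGroup (PairCochain C n)
  | 0 => (inferInstance : AddCommGroup PUnit.{w + 1})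
  | 1 => (inferInstance : AddCommGroup (C 1))
  | n + 2 => (inferInstance : AddCommGroup (C (n + 2) × C (n + 1)))

instance PairCochain.instModule (K : Type*) [Field K] (C : ℕ → Type w) [∀ n, AddCommGroup (C n)]
    [∀ n, Module K (C n)] : ∀ n, Module K (PairCochain C n)
  | 0 => (inferInstance : Module K PUnit.{w + 1})
  | 1 => (inferInstance : Module K (C 1))
  | n + 2 => (inferInstance : Module K (C (n + 2) × C (n + 1)))

variable {K : Type*} [Field K] {C C' : ℕ → Type*} [∀ n, AddCommGroup (C n)] [∀ n, Module K (C n)]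
  [∀ n, AddCommGroup (C' n)] [∀ n, Module K (C' n)]

/-- The degreewise map `(S_n, S_{n-1})` (just `S_1` in degree `1`). -/
def pairMap (S : ∀ n, C n →ₗ[K] C' n) : ∀ n, PairCochain C n →ₗ[K] PairCochain C' n
  | 0 => 0
  | 1 => S 1
  | n + 2 => (S (n + 2)).prodMap (S (n + 1))

/-- The map `f ↦ (δ f, ψ f)` in degree `1` and `(f, g) ↦ (δ f, δ' g + ψ f)` in degrees `n ≥ 2`.
Here `δ n` and `δ' n` are the coboundaries on cochains of degree `n + 1`. -/
def pairD (δ δ' : ∀ n, C (n + 1) →ₗ[K] C (n + 2)) (ψ : ∀ n, C n →ₗ[K] C n) :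
    ∀ n, PairCochain C n →ₗ[K] PairCochain C (n + 1)
  | 0 => 0
  | 1 => (δ 0).prod (ψ 1)
  | n + 2 => (δ (n + 1) ∘ₗ LinearMap.fst K (C (n + 2)) (C (n + 1))).prod
      (δ' n ∘ₗ LinearMap.snd K (C (n + 2)) (C (n + 1)) +
        ψ (n + 2) ∘ₗ LinearMap.fst K (C (n + 2)) (C (n + 1)))

/-- The `n`-cocycles of a sequence of maps `D n : C n → C (n + 1)`. -/
def cocycles (D : ∀ n, C n →ₗ[K] C (n + 1)) (n : ℕ) : Submodule K (C n) :=
  LinearMap.ker (D n)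

/-- The `n`-coboundaries. -/
def coboundaries (D : ∀ n, C n →ₗ[K] C (n + 1)) : ∀ n, Submodule K (C n)
  | 0 => ⊥
  | n + 1 => LinearMap.range (D n)

/-- The `n`-th cohomology space: `n`-cocycles modulo `n`-coboundaries. -/
abbrev Cohomology (D : ∀ n, C n →ₗ[K] C (n + 1)) (n : ℕ) : Type _ :=
  cocycles D n ⧸ (coboundaries D n).comap (cocycles D n).subtype

/-- The cohomology class of a cocycle. -/
def cohomologyClass (D : ∀ n, C n →ₗ[K] C (n + 1)) (n : ℕ) :
    cocycles D n →ₗ[K] Cohomology D n :=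
  Submodule.mkQ _

end Pairs

section Complexes

/-- The cochains of a modified Rota-Baxter associative algebra: `Hom(A, M)` in degree `1` and
`C^n(A; M) ⊕ C^{n-1}(A; M)` in degree `n ≥ 2`. -/
abbrev RBAssCochain (K : Type*) [Field K] (A M : Type*) [AddCommGroup A] [Module K A]
    [AddCommGroup M] [Module K M] : ℕ → Type _ :=
  PairCochain (HochCochain K A M)

/-- The cochains of a modified Rota-Baxter AssDer pair. -/
abbrev AssDerCochain (K : Type*) [Field K] (A M : Type*) [AddCommGroup A] [Module K A]
    [AddCommGroup M] [Module K M] : ℕ → Type _ :=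
  PairCochain (RBAssCochain K A M)

/-- The cochains of a modified Rota-Baxter Lie algebra: `Hom(L, M)` in degree `1` and
`Hom(⋀^n L, M) ⊕ Hom(⋀^{n-1} L, M)` in degree `n ≥ 2`. -/
abbrev RBLieCochain (K : Type*) [Field K] (L M : Type*) [AddCommGroup L] [Module K L]
    [AddCommGroup M] [Module K M] : ℕ → Type _ :=
  PairCochain (CECochain K L M)

/-- The cochains of a modified Rota-Baxter LieDer pair. -/
abbrev LieDerCochain (K : Type*) [Field K] (L M : Type*) [AddCommGroup L] [Module K L]
    [AddCommGroup M] [Module K M] : ℕ → Type _ :=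
  PairCochain (RBLieCochain K L M)

variable {K : Type*} [Field K] {κ : K} {A M : Type*} [AddCommGroup A] [Module K A]
  [AddCommGroup M] [Module K M]

/-- The induced multiplication `μ_R(a, b) = R(a) b + a R(b)`. -/
def AssDerPair.mulR (P : AssDerPair κ A) : A →ₗ[K] A →ₗ[K] A :=
  P.mul ∘ₗ P.R + P.mul.compl₂ P.R

/-- The induced left action `l̃(a, m) = l(R(a), m) - R_M(l(a, m))`. -/
def AssBimodule.lR {P : AssDerPair κ A} (N : AssBimodule P M) : A →ₗ[K] M →ₗ[K] M :=
  N.l ∘ₗ P.R - N.l.compr₂ N.RM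

/-- The induced right action `r̃(m, a) = r(m, R(a)) - R_M(r(m, a))`. -/
def AssBimodule.rR {P : AssDerPair κ A} (N : AssBimodule P M) : M →ₗ[K] A →ₗ[K] M :=
  N.r.compl₂ P.R - N.r.compr₂ N.RM

/-- The coboundary `∂(f, g) = (δ f, -δ_R g - φ f)`, where `δ` is the Hochschild coboundary of `A`
with values in `M` and `δ_R` that of the induced algebra with values in the induced bimodule. -/
def AssBimodule.partialD {P : AssDerPair κ A} (N : AssBimodule P M) :
    ∀ n, RBAssCochain K A M n →ₗ[K] RBAssCochain K A M (n + 1) :=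
  pairD (fun n => hochD P.mul N.l N.r (n + 1)) (fun n => -hochD P.mulR N.lR N.rR (n + 1))
    (fun n => -phiHoch κ P.R N.RM n)

/-- `Δ(f, g) = (Δ f, Δ g)`. -/
def AssBimodule.delta {P : AssDerPair κ A} (N : AssBimodule P M) :
    ∀ n, RBAssCochain K A M n →ₗ[K] RBAssCochain K A M n :=
  pairMap (deltaHoch P.d N.dM)

/-- The coboundary of a modified Rota-Baxter AssDer pair with coefficients in a bimodule:
`𝔇(f) = (∂ f, -Δ f)` in degree `1`, `𝔇(F, G) = (∂ F, ∂ G + (-1)^n Δ F)` in degree `n ≥ 2`. -/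
def AssBimodule.D {P : AssDerPair κ A} (N : AssBimodule P M) :
    ∀ n, AssDerCochain K A M n →ₗ[K] AssDerCochain K A M (n + 1) :=
  pairD (fun n => N.partialD (n + 1)) (fun n => N.partialD (n + 1))
    (fun n => (-1 : K) ^ n • N.delta n)

/-- The induced bracket `[x, y]_R = [R x, y] + [x, R y]`. -/
def LieDerPair.bracketR (Q : LieDerPair κ A) : A →ₗ[K] A →ₗ[K] A :=
  Q.bracket ∘ₗ Q.R + Q.bracket.compl₂ Q.R

theorem LieDerPair.bracketR_self (Q : LieDerPair κ A) (x : A) : Q.bracketR x x = 0 := by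
  have h := Q.bracket_self (Q.R x + x)
  simp only [map_add, LinearMap.add_apply, Q.bracket_self, zero_add, add_zero] at h
  simpa [LieDerPair.bracketR, add_comm] using h

/-- The induced action `ρ_R(x) m = ρ(R x) m - R_M(ρ(x) m)`. -/
def LieRep.ρR {Q : LieDerPair κ A} (V : LieRep Q M) : A →ₗ[K] M →ₗ[K] M :=
  V.ρ ∘ₗ Q.R - V.ρ.compr₂ V.RM

/-- The coboundary `∂(f, g) = (δ f, -δ_R g - φ f)`, where `δ` is the Chevalley-Eilenberg coboundary
of `L` with values in `M` and `δ_R` that of the induced Lie algebra with values in the induced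
representation. -/
def LieRep.partialD {Q : LieDerPair κ A} (V : LieRep Q M) :
    ∀ n, RBLieCochain K A M n →ₗ[K] RBLieCochain K A M (n + 1) :=
  pairD (fun n => ceD Q.bracket Q.bracket_self V.ρ n)
    (fun n => -ceD Q.bracketR Q.bracketR_self V.ρR n) (fun n => -phiCE κ Q.R V.RM n)

/-- `Δ(f, g) = (Δ f, Δ g)`. -/
def LieRep.delta {Q : LieDerPair κ A} (V : LieRep Q M) :
    ∀ n, RBLieCochain K A M n →ₗ[K] RBLieCochain K A M n :=
  pairMap (deltaCE Q.d V.dM)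

/-- The coboundary of a modified Rota-Baxter LieDer pair with coefficients in a representation:
`𝔇(f) = (∂ f, -Δ f)` in degree `1`, `𝔇(F, G) = (∂ F, ∂ G + (-1)^n Δ F)` in degree `n ≥ 2`. -/
def LieRep.D {Q : LieDerPair κ A} (V : LieRep Q M) :
    ∀ n, LieDerCochain K A M n →ₗ[K] LieDerCochain K A M (n + 1) :=
  pairD (fun n => V.partialD (n + 1)) (fun n => V.partialD (n + 1))
    (fun n => (-1 : K) ^ n • V.delta n)

/-- The map `𝔖_n = (𝒮_n, 𝒮_{n-1})`, where `𝒮_n = (S_n, S_{n-1})` and `S_n` is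
skew-symmetrization. -/
def skewMap (K : Type*) [Field K] (A M : Type*) [AddCommGroup A] [Module K A]
    [AddCommGroup M] [Module K M] : ∀ n, AssDerCochain K A M n →ₗ[K] LieDerCochain K A M n :=
  pairMap (pairMap skew)

end Complexes

end ModifiedRB

/-! The coboundary `𝔇` is assembled from `δ`, `δ_R`, `φ` and `Δ` by applying one block construction
(`pairD`) twice. Commutation with a degreewise map passes formally through that construction
(`pairD_comp_pairMap`), so it suffices that skew-symmetrization commutes with each building block.

For `φ` and `Δ` this is reindexing: permuting the arguments permutes the subsets, respectively the
positions, summed over, and the coefficients depend only on the cardinality of the subset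
(`skew_phiHoch`, `skew_deltaHoch`).

For `δ` the sum over permutations is expanded like a determinant along a row or a column. Fixing the
first or last argument turns the two action terms into the alternating sum for `ρ = l - r`. In a
product term the two adjacent factors are extracted; summing over the place of the product rebuilds
the skew-symmetrization of `f` with the product in front, and the two orders of the factors combine
into a commutator (`sum_skew_contractTerm_eq_bracketSum`). The resulting `skew_hochD` is an identity
for arbitrary bilinear maps. It therefore covers `δ_R` as well, since passing to commutators
commutes with forming the structures induced by `R` and `R_M`.

A cochain map preserves cocycles and coboundaries and so descends uniquely to the quotients. -/

namespace ModifiedRB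

/-! ### Expansion of signed sums over permutations along a row or a column. -/

section PermSums

variable {N : Type*} [AddCommGroup N]

/-- The permutation of `Fin (n + 1)` fixing `0` that acts on the successors as `τ`. -/
def liftPerm {n : ℕ} (τ : Equiv.Perm (Fin n)) : Equiv.Perm (Fin (n + 1)) :=
  Equiv.Perm.decomposeFin.symm (0, τ)

theorem liftPerm_zero {n : ℕ} (τ : Equiv.Perm (Fin n)) : liftPerm τ 0 = 0 := by
  simp [liftPerm]

theorem liftPerm_succ {n : ℕ} (τ : Equiv.Perm (Fin n)) (k : Fin n) :
    liftPerm τ k.succ = (τ k).succ := by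
  simp [liftPerm]

theorem sign_liftPerm {n : ℕ} (τ : Equiv.Perm (Fin n)) :
    Equiv.Perm.sign (liftPerm τ) = Equiv.Perm.sign τ := by
  simp [liftPerm]

theorem liftPerm_inv {n : ℕ} (τ : Equiv.Perm (Fin n)) : liftPerm τ⁻¹ = (liftPerm τ)⁻¹ := by
  rw [eq_inv_iff_mul_eq_one]
  ext k
  refine Fin.cases ?_ (fun k => ?_) k
  · simp [liftPerm_zero]
  · simp [liftPerm_succ]

/-- The permutation sending `p` to `i` that corresponds to `τ` on the complements. -/
def insertPerm {n : ℕ} (p i : Fin (n + 1)) (τ : Equiv.Perm (Fin n)) : Equiv.Perm (Fin (n + 1)) :=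
  i.cycleRange⁻¹ * liftPerm τ * p.cycleRange

theorem insertPerm_self {n : ℕ} (p i : Fin (n + 1)) (τ : Equiv.Perm (Fin n)) :
    insertPerm p i τ p = i := by
  simp [insertPerm, liftPerm_zero, Equiv.Perm.inv_def]

theorem insertPerm_succAbove {n : ℕ} (p i : Fin (n + 1)) (τ : Equiv.Perm (Fin n)) (k : Fin n) :
    insertPerm p i τ (p.succAbove k) = i.succAbove (τ k) := by
  simp [insertPerm, liftPerm_succ, Equiv.Perm.inv_def]

/-- `p.cycleRange` brings `p` to the front and keeps the order of the other positions; it is a cycle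
of length `p + 1`, hence of sign `(-1) ^ p`. The factor for `i` arises in the same way. -/
theorem sign_insertPerm {n : ℕ} (p i : Fin (n + 1)) (τ : Equiv.Perm (Fin n)) :
    Equiv.Perm.sign (insertPerm p i τ) = (-1) ^ ((i : ℕ) + p) * Equiv.Perm.sign τ := by
  simp only [insertPerm, map_mul, map_inv, sign_liftPerm, Fin.sign_cycleRange, pow_add,
    Int.units_inv_eq_self]
  exact mul_right_comm _ _ _

theorem insertPerm_inv {n : ℕ} (p i : Fin (n + 1)) (τ : Equiv.Perm (Fin n)) :
    insertPerm p i τ⁻¹ = (insertPerm i p τ)⁻¹ := by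
  simp [insertPerm, liftPerm_inv, mul_assoc]

theorem insertPerm_bijective {n : ℕ} (p : Fin (n + 1)) :
    Function.Bijective fun x : Fin (n + 1) × Equiv.Perm (Fin n) => insertPerm p x.1 x.2 := by
  rw [Fintype.bijective_iff_injective_and_card]
  refine ⟨?_, by simp [Fintype.card_perm, Nat.factorial_succ]⟩
  rintro ⟨i, τ⟩ ⟨j, υ⟩ h
  have hij : i = j := by
    have := congrArg (· p) h
    simpa [insertPerm_self] using this
  subst hij
  simp only [Prod.mk.injEq, true_and]
  ext k : 1
  have := congrArg (· (p.succAbove k)) h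
  simpa [insertPerm_succAbove] using this

/-- Summation over permutations sorted by the image of `p`. -/
theorem sum_perm_eq_sum_image {n : ℕ} (p : Fin (n + 1)) (G : Equiv.Perm (Fin (n + 1)) → N) :
    ∑ σ, G σ = ∑ i, ∑ τ, G (insertPerm p i τ) := by
  rw [← Fintype.sum_prod_type' (fun i τ => G (insertPerm p i τ))]
  exact ((insertPerm_bijective p).sum_comp G).symm

/-- Summation over permutations sorted by the preimage of `i`. -/
theorem sum_perm_eq_sum_preimage {n : ℕ} (i : Fin (n + 1)) (G : Equiv.Perm (Fin (n + 1)) → N) :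
    ∑ σ, G σ = ∑ p, ∑ τ, G (insertPerm p i τ) := by
  -- Inversion exchanges images and preimages; the second inversion below, on `τ`, undoes its effect
  -- on the complement.
  rw [← Equiv.sum_comp (Equiv.inv _), sum_perm_eq_sum_image i]
  refine Finset.sum_congr rfl fun p _ => ?_
  rw [← Equiv.sum_comp (Equiv.inv _)]
  refine Finset.sum_congr rfl fun τ _ => ?_
  simp [insertPerm_inv]

variable {L : Type*}

theorem comp_insertPerm {n : ℕ} (p i : Fin (n + 1)) (τ : Equiv.Perm (Fin n)) (v : Fin (n + 1) → L) :
    (fun k => v (insertPerm p i τ k)) = p.insertNth (v i) (fun k => i.removeNth v (τ k)) := by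
  refine (Fin.insertNth_eq_iff.2 ⟨?_, ?_⟩).symm
  · rw [insertPerm_self]
  · ext k
    simp [Fin.removeNth, insertPerm_succAbove]

theorem neg_one_pow_units_smul (m : ℕ) (u : ℤˣ) (x : N) :
    ((-1 : ℤˣ) ^ m * u) • x = (-1 : ℤ) ^ m • u • x := by
  rw [mul_smul, Units.smul_def ((-1 : ℤˣ) ^ m)]
  simp

/-- Laplace expansion with the position `p` fixed: the entry `v i` placed there varies. -/
theorem sum_sign_smul_eq_sum_image {n : ℕ} (p : Fin (n + 1)) (F : (Fin (n + 1) → L) → N)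
    (v : Fin (n + 1) → L) :
    ∑ σ : Equiv.Perm (Fin (n + 1)), Equiv.Perm.sign σ • F (fun k => v (σ k)) =
      ∑ i : Fin (n + 1), (-1 : ℤ) ^ ((i : ℕ) + p) • ∑ τ : Equiv.Perm (Fin n),
        Equiv.Perm.sign τ • F (p.insertNth (v i) (fun k => i.removeNth v (τ k))) := by
  rw [sum_perm_eq_sum_image p]
  simp only [comp_insertPerm, sign_insertPerm, neg_one_pow_units_smul, Finset.smul_sum]

/-- The transposed expansion: the entry `v i` is fixed and travels through all positions `p`. -/
theorem sum_sign_smul_eq_sum_preimage {n : ℕ} (i : Fin (n + 1)) (F : (Fin (n + 1) → L) → N)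
    (v : Fin (n + 1) → L) :
    ∑ σ : Equiv.Perm (Fin (n + 1)), Equiv.Perm.sign σ • F (fun k => v (σ k)) =
      ∑ p : Fin (n + 1), (-1 : ℤ) ^ ((i : ℕ) + p) • ∑ τ : Equiv.Perm (Fin n),
        Equiv.Perm.sign τ • F (p.insertNth (v i) (fun k => i.removeNth v (τ k))) := by
  rw [sum_perm_eq_sum_preimage i]
  simp only [comp_insertPerm, sign_insertPerm, neg_one_pow_units_smul, Finset.smul_sum]

end PermSums

/-! ### Skew-symmetrization against `δ`, `φ` and `Δ`. -/

section Skew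

variable {K : Type*} [Field K] {A M : Type*} [AddCommGroup A] [Module K A] [AddCommGroup M]
  [Module K M]

/-- Expansion along the entry `x`. Read from right to left, it collects the terms in which a product
occupies each possible place of `f`. -/
theorem skew_cons {n : ℕ} (f : HochCochain K A M (n + 1)) (x : A) (u : Fin n → A) :
    skew (n + 1) f (Fin.cons x u) = ∑ p : Fin (n + 1), (-1 : ℤ) ^ (p : ℕ) •
      ∑ τ : Equiv.Perm (Fin n), Equiv.Perm.sign τ • f (p.insertNth x (fun k => u (τ k))) := by
  rw [skew_apply, sum_sign_smul_eq_sum_preimage 0 (fun w => f w)]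
  simp [Fin.removeNth_zero]

theorem skew_leftTerm (l : A →ₗ[K] M →ₗ[K] M) {n : ℕ} (f : HochCochain K A M n)
    (v : Fin (n + 1) → A) :
    skew (n + 1) (leftTerm l f) v =
      ∑ i : Fin (n + 1), (-1 : ℤ) ^ (i : ℕ) • l (v i) (skew n f (i.removeNth v)) := by
  rw [skew_apply, sum_sign_smul_eq_sum_image 0 (fun w => leftTerm l f w)]
  simp only [skew_apply, leftTerm, MultilinearMap.mk'_apply, Fin.insertNth_zero', Fin.cons_zero,
    Fin.tail_cons, map_sum, Units.smul_def, map_zsmul]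
  simp

theorem skew_rightTerm (r : M →ₗ[K] A →ₗ[K] M) {n : ℕ} (f : HochCochain K A M n)
    (v : Fin (n + 1) → A) :
    skew (n + 1) (rightTerm r f) v =
      ∑ i : Fin (n + 1), (-1 : ℤ) ^ ((i : ℕ) + n) • r (skew n f (i.removeNth v)) (v i) := by
  rw [skew_apply, sum_sign_smul_eq_sum_image (Fin.last n) (fun w => rightTerm r f w)]
  simp only [skew_apply, rightTerm, MultilinearMap.mk'_apply, Fin.insertNth_last', Fin.init_snoc,
    Fin.snoc_last, map_sum, Units.smul_def, map_zsmul, LinearMap.sum_apply, LinearMap.smul_apply,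
    Fin.val_last]

/-- The two insertions make `a` and `b` neighbours at positions `k` and `k + 1`, because
`k.castSucc.succAbove k = k.succ`; these are exactly the entries that the contraction multiplies. -/
theorem contractNth_insertNth_insertNth {X : Type*} (op : X → X → X) {n : ℕ}
    (k : Fin (n + 1)) (a b : X)
    (u : Fin n → X) :
    Fin.contractNth k.castSucc op
        (k.castSucc.insertNth a (k.insertNth b u : Fin (n + 1) → X) : Fin (n + 2) → X) =
      (k.insertNth (op a b) u : Fin (n + 1) → X) := by
  have hs : k.castSucc.succAbove k = k.succ := Fin.succAbove_of_le_castSucc _ _ le_rfl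
  refine Fin.eq_insertNth_iff.2 ⟨?_, ?_⟩
  · have : (k.castSucc.insertNth a (k.insertNth b u : Fin (n + 1) → X) : Fin (n + 2) → X) k.succ
        = b := by
      rw [← hs, Fin.insertNth_apply_succAbove, Fin.insertNth_apply_same]
    simp [Fin.contractNth, this]
  · ext j
    simp only [Fin.removeNth]
    rcases lt_or_ge j.castSucc k with h | h
    · rw [Fin.succAbove_of_castSucc_lt _ _ h, Fin.contractNth_apply_of_lt _ _ _ _ h]
      have e : j.castSucc.castSucc = k.castSucc.succAbove (k.succAbove j) := by
        rw [Fin.succAbove_of_castSucc_lt k _ h, Fin.succAbove_of_castSucc_lt _ _ (by simpa using h)]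
      rw [e]; simp
    · rw [Fin.succAbove_of_le_castSucc _ _ h, Fin.contractNth_apply_of_gt]
      · have e : j.succ.succ = k.castSucc.succAbove (k.succAbove j) := by
          rw [Fin.succAbove_of_le_castSucc k _ h, Fin.succAbove_of_le_castSucc]
          exact Fin.castSucc_le_castSucc_iff.2 (h.trans (Fin.castSucc_lt_succ).le)
        rw [e]; simp
      · have : (k : ℕ) ≤ j := h
        simp; omega

/-- Two successive expansions, at positions `k` and `k + 1`, isolate the two factors of the product;
`j` is counted after the removal of `i`. -/
theorem skew_contractTerm (mul : A →ₗ[K] A →ₗ[K] A) {n : ℕ} (k : Fin (n + 1))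
    (f : HochCochain K A M (n + 1)) (v : Fin (n + 2) → A) :
    skew (n + 2) (contractTerm mul k f) v =
      ∑ i : Fin (n + 2), ∑ j : Fin (n + 1), (-1 : ℤ) ^ ((i : ℕ) + j) •
        ∑ τ : Equiv.Perm (Fin n), Equiv.Perm.sign τ • f (k.insertNth (mul (v i) (i.removeNth v j))
          (fun q => j.removeNth (i.removeNth v) (τ q))) := by
  rw [skew_apply, sum_sign_smul_eq_sum_image k.castSucc (fun w => contractTerm mul k f w)]
  refine Finset.sum_congr rfl fun i _ => ?_
  rw [sum_sign_smul_eq_sum_image k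
    (fun w => contractTerm mul k f (k.castSucc.insertNth (v i) w)), Finset.smul_sum]
  refine Finset.sum_congr rfl fun j _ => ?_
  rw [smul_smul]
  congr 1
  -- Each expansion contributes a factor `(-1) ^ k`. They cancel, so the remaining sign does not
  -- depend on `k`.
  · have : (-1 : ℤ) ^ (k : ℕ) * (-1) ^ (k : ℕ) = 1 := by rw [← mul_pow]; simp
    simp only [Fin.val_castSucc, pow_add]
    linear_combination ((-1 : ℤ) ^ (i : ℕ) * (-1) ^ (j : ℕ)) * this
  · refine Finset.sum_congr rfl fun τ _ => ?_
    congr 1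
    exact congrArg f (contractNth_insertNth_insertNth (fun a b => mul a b) k _ _ _)

/-- The Hochschild sign `(-1) ^ k` is precisely the sign with which `skew_cons` moves the product
from the front to position `k`. -/
theorem sum_skew_contractTerm (mul : A →ₗ[K] A →ₗ[K] A) {n : ℕ} (f : HochCochain K A M (n + 1))
    (v : Fin (n + 2) → A) :
    ∑ k : Fin (n + 1), (-1 : ℤ) ^ (k : ℕ) • skew (n + 2) (contractTerm mul k f) v =
      ∑ i : Fin (n + 2), ∑ j : Fin (n + 1), (-1 : ℤ) ^ ((i : ℕ) + j) •
        skew (n + 1) f (Fin.cons (mul (v i) (i.removeNth v j))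
          (j.removeNth (i.removeNth v))) := by
  simp only [skew_contractTerm, Finset.smul_sum, skew_cons]
  rw [Finset.sum_comm]
  refine Finset.sum_congr rfl fun i _ => ?_
  rw [Finset.sum_comm]
  refine Finset.sum_congr rfl fun j _ => Finset.sum_congr rfl fun k _ =>
    Finset.sum_congr rfl fun τ _ => ?_
  rw [smul_comm]

/-- A double sum over ordered pairs of distinct positions as a sum over increasing pairs. -/
theorem sum_succAbove_eq {N : Type*} [AddCommGroup N] {n : ℕ} (G : Fin (n + 2) → Fin (n + 1) → N) :
    ∑ i, ∑ j, G i j = ∑ a : Fin (n + 1), ∑ b : Fin (n + 1),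
      if a ≤ b then G a.castSucc b + G b.succ a else 0 := by
  have h : ∀ i j, G i j = (if i ≤ j.castSucc then G i j else 0) +
      (if j.castSucc < i then G i j else 0) := fun i j => by
    rcases le_or_gt i j.castSucc with h | h
    · simp [h, h.not_gt]
    · simp [h, h.not_ge]
  have h' : ∀ a b : Fin (n + 1), (if a ≤ b then G a.castSucc b + G b.succ a else 0) =
      (if a ≤ b then G a.castSucc b else 0) + (if a ≤ b then G b.succ a else 0) := fun a b => by
    split_ifs <;> simp
  simp only [h', Finset.sum_add_distrib]
  rw [Finset.sum_congr rfl fun i _ => Finset.sum_congr rfl fun j _ => h i j]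
  simp only [Finset.sum_add_distrib]
  congr 1
  -- The index `i = Fin.last _` lies above every `j.castSucc` and contributes nothing.
  · rw [Fin.sum_univ_castSucc]
    simp
  -- Here `i = 0` contributes nothing, and `j.castSucc < b.succ` means `j ≤ b`.
  · rw [Fin.sum_univ_succ, Finset.sum_comm]
    simp

/-- For `a ≤ b`, deleting entry `b + 1` and then entry `a` leaves the same list as deleting `a`
first; after that deletion, the old entry `b + 1` has index `b`. -/
theorem cons_removeNth_succ_eq {X : Type*} (op : X → X → X) {n : ℕ} {a b : Fin (n + 1)} (hab : a ≤ b)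
    (v : Fin (n + 2) → X) :
    (Fin.cons (op (v b.succ) (b.succ.removeNth v a)) (a.removeNth (b.succ.removeNth v)) :
        Fin (n + 1) → X) =
      Fin.cons (op (v b.succ) (v a.castSucc)) (b.removeNth (a.castSucc.removeNth v)) := by
  have h1 : b.succ.succAbove a = a.castSucc :=
    Fin.succAbove_of_castSucc_lt _ _ (by simpa [Fin.lt_def, Nat.lt_succ_iff] using hab)
  have h2 : a.removeNth (b.succ.removeNth v) = b.removeNth (a.castSucc.removeNth v) := by
    ext k
    simp only [Fin.removeNth]
    congr 1
    have hab' : (a : ℕ) ≤ b := hab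
    simp only [Fin.succAbove, Fin.lt_def, Fin.ext_iff]
    split_ifs <;> simp_all <;> omega
  rw [h2]
  simp [Fin.removeNth, h1]

/-- Each pair of positions `a < b + 1` occurs in both orders, with signs `(-1) ^ (a + b)` and `(-1)
^ (b + 1 + a)`. The remaining arguments agree, so the opposite signs produce a commutator in the
first slot. -/
theorem sum_skew_contractTerm_eq_bracketSum (mul : A →ₗ[K] A →ₗ[K] A) {n : ℕ}
    (f : HochCochain K A M (n + 1)) (v : Fin (n + 2) → A) :
    ∑ k : Fin (n + 1), (-1 : ℤ) ^ (k : ℕ) • skew (n + 2) (contractTerm mul k f) v =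
      bracketSum (mul - mul.flip) (skew (n + 1) f) v := by
  rw [sum_skew_contractTerm, sum_succAbove_eq, bracketSum_apply]
  refine Finset.sum_congr rfl fun a _ => Finset.sum_congr rfl fun b _ => ?_
  split_ifs with hab
  · have hs : a.castSucc.succAbove b = b.succ :=
      Fin.succAbove_of_le_castSucc _ _ (by simpa using hab)
    rw [cons_removeNth_succ_eq (fun x y => mul x y) hab]
    have e : skew (n + 1) f (bracketArgs (mul - mul.flip) a b v) =
        skew (n + 1) f (Fin.cons (mul (v a.castSucc) (v b.succ))
          (b.removeNth (a.castSucc.removeNth v))) -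
        skew (n + 1) f (Fin.cons (mul (v b.succ) (v a.castSucc))
          (b.removeNth (a.castSucc.removeNth v))) := by
      have := (skew (n + 1) f).map_update_sub
        (Fin.cons 0 (b.removeNth (a.castSucc.removeNth v))) 0
        (mul (v a.castSucc) (v b.succ)) (mul (v b.succ) (v a.castSucc))
      simp only [Fin.update_cons_zero] at this
      exact this
    rw [e, ← Int.cast_smul_eq_zsmul K, ← Int.cast_smul_eq_zsmul K]
    simp only [Fin.removeNth, hs, Fin.val_castSucc, Fin.val_succ]
    push_cast
    rw [smul_sub, sub_eq_add_neg, ← neg_smul]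
    congr 2
    ring
  · rfl

theorem alternatingMap_sum_apply {α : Type*} {n : ℕ} (s : Finset α) (g : α → CECochain K A M n)
    (v : Fin n → A) : (∑ a ∈ s, g a) v = ∑ a ∈ s, g a v :=
  map_sum ({ toFun := fun h => h v, map_zero' := rfl, map_add' := fun _ _ => rfl } :
    CECochain K A M n →+ M) g s

/-- Skew-symmetrization intertwines the Hochschild coboundary with the Chevalley-Eilenberg
coboundary of the commutator structures. -/
theorem skew_hochD (mul : A →ₗ[K] A →ₗ[K] A) (l : A →ₗ[K] M →ₗ[K] M) (r : M →ₗ[K] A →ₗ[K] M)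
    (br : A →ₗ[K] A →ₗ[K] A) (hbr : ∀ x, br x x = 0) (ρ : A →ₗ[K] M →ₗ[K] M)
    (hb : br = mul - mul.flip) (hρ : ρ = l - r.flip) (n : ℕ) (f : HochCochain K A M (n + 1)) :
    ceD br hbr ρ n (skew (n + 1) f) = skew (n + 2) (hochD mul l r (n + 1) f) := by
  ext v
  have hD : hochD mul l r (n + 1) f = (-1 : K) ^ (n + 1 + 1) • leftTerm l f + rightTerm r f +
    ∑ i : Fin (n + 1), (-1 : K) ^ ((i : ℕ) + 1 + (n + 1) + 1) • contractTerm mul i f := rfl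
  have hce : ceD br hbr ρ n (skew (n + 1) f) v = (-1 : K) ^ n •
    (AlternatingMap.alternatizeUncurryFin (actCurry ρ (skew (n + 1) f)) v -
      bracketSum br (skew (n + 1) f) v) := rfl
  rw [hD, hce, hb, ← sum_skew_contractTerm_eq_bracketSum, map_add, map_add, map_smul, map_sum,
    AlternatingMap.add_apply, AlternatingMap.add_apply, AlternatingMap.smul_apply,
    alternatingMap_sum_apply, skew_leftTerm, skew_rightTerm, smul_sub, sub_eq_add_neg]
  congr 1
  -- Action part: the left term has sign `(-1) ^ (n + 2 + i)` and the right term `(-1) ^ (i + n +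
  -- 1)`. They are opposite, which gives `l - r.flip`.
  · rw [AlternatingMap.alternatizeUncurryFin_apply, Finset.smul_sum, Finset.smul_sum,
      ← Finset.sum_add_distrib]
    refine Finset.sum_congr rfl fun i _ => ?_
    simp only [← Int.cast_smul_eq_zsmul K, smul_smul, hρ, actCurry, LinearMap.coe_mk,
      AddHom.coe_mk, LinearMap.compAlternatingMap_apply, LinearMap.sub_apply,
      LinearMap.flip_apply, smul_sub]
    push_cast
    rw [sub_eq_add_neg, ← neg_smul]
    congr 2 <;> ring
  -- Bracket part: `-(-1) ^ n * (-1) ^ k` equals the Hochschild sign `(-1) ^ (k + 1 + (n + 1) + 1)`.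
  · rw [Finset.smul_sum, ← Finset.sum_neg_distrib]
    refine Finset.sum_congr rfl fun k _ => ?_
    rw [map_smul, AlternatingMap.smul_apply, ← Int.cast_smul_eq_zsmul K, smul_smul, ← neg_smul]
    push_cast
    congr 1
    ring

/-- For each `σ`, a set `s` of argument positions corresponds to the set `σ(s)` of entries of `v`
left alone. Since both have the same cardinality, `phiCoeff` is unchanged. -/
theorem skew_phiHoch (κ : K) (R : A →ₗ[K] A) (RM : M →ₗ[K] M) (n : ℕ)
    (f : HochCochain K A M n) :
    phiCE κ R RM n (skew n f) = skew n (phiHoch κ R RM n f) := by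
  ext v
  have h : phiCE κ R RM n (skew n f) v = ∑ s : Finset (Fin n),
      phiCoeff κ RM s.card (skew n f (fun i => if i ∈ s then v i else R (v i))) :=
    phiHoch_apply κ R RM n (skew n f).toMultilinearMap v
  rw [h, skew_apply]
  simp only [skew_apply, phiHoch_apply, map_sum, Finset.smul_sum]
  rw [Finset.sum_comm]
  refine Finset.sum_congr rfl fun σ _ => ?_
  refine (Fintype.sum_equiv σ.finsetCongr _ _ fun s => ?_).symm
  simp [Equiv.finsetCongr_apply, Units.smul_def]

/-- Applying `d` at position `i` after permuting by `σ` amounts to applying it to entry `σ i`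
before; `dM` commutes with signed sums by linearity. -/
theorem skew_deltaHoch (d : A →ₗ[K] A) (dM : M →ₗ[K] M) (n : ℕ) (f : HochCochain K A M n) :
    deltaCE d dM n (skew n f) = skew n (deltaHoch d dM n f) := by
  ext v
  have h : deltaCE d dM n (skew n f) v =
      ∑ i : Fin n, skew n f (Function.update v i (d (v i))) - dM (skew n f v) :=
    deltaHoch_apply d dM n (skew n f).toMultilinearMap v
  rw [h, skew_apply]
  simp only [skew_apply, deltaHoch_apply, smul_sub, map_sum, Finset.smul_sum,
    Finset.sum_sub_distrib]
  congr 1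
  · rw [Finset.sum_comm]
    refine Finset.sum_congr rfl fun σ _ => ?_
    refine (Fintype.sum_equiv σ _ _ fun i => ?_).symm
    congr 2
    ext k
    simp [Function.update_apply]
  · simp [Units.smul_def]

end Skew

/-! ### Formal part: cochain maps for the block construction and in cohomology. -/

section Pairs

variable {K : Type*} [Field K] {C C' : ℕ → Type*}
  [∀ n, AddCommGroup (C n)] [∀ n, Module K (C n)]
  [∀ n, AddCommGroup (C' n)] [∀ n, Module K (C' n)]

/-- The three maps are kept independent because the lemma serves at two levels: with `δ`, `-δ_R`,
`-φ` for `∂`, and with `∂`, `∂`, `(-1) ^ n • Δ` for `𝔇`. -/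
theorem pairD_comp_pairMap (S : ∀ n, C n →ₗ[K] C' n)
    {δ₁ δ₂ : ∀ n, C (n + 1) →ₗ[K] C (n + 2)} {ψ : ∀ n, C n →ₗ[K] C n}
    {δ₁' δ₂' : ∀ n, C' (n + 1) →ₗ[K] C' (n + 2)} {ψ' : ∀ n, C' n →ₗ[K] C' n}
    (h₁ : ∀ n, δ₁' n ∘ₗ S (n + 1) = S (n + 2) ∘ₗ δ₁ n)
    (h₂ : ∀ n, δ₂' n ∘ₗ S (n + 1) = S (n + 2) ∘ₗ δ₂ n)
    (hψ : ∀ n, ψ' n ∘ₗ S n = S n ∘ₗ ψ n) :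
    ∀ n, pairD δ₁' δ₂' ψ' n ∘ₗ pairMap S n = pairMap S (n + 1) ∘ₗ pairD δ₁ δ₂ ψ n
  | 0 => by
    ext x
    exact (map_zero (pairMap S 1)).symm
  | 1 => LinearMap.ext fun x => Prod.ext (LinearMap.congr_fun (h₁ 0) x)
      (LinearMap.congr_fun (hψ 1) x)
  | n + 2 => LinearMap.ext fun x => Prod.ext (LinearMap.congr_fun (h₁ (n + 1)) x.1) <|
      (congrArg₂ (· + ·) (LinearMap.congr_fun (h₂ n) x.2)
        (LinearMap.congr_fun (hψ (n + 2)) x.1)).trans (map_add (S (n + 2)) _ _).symm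

theorem pairMap_comp_pairMap_comm (S : ∀ n, C n →ₗ[K] C' n)
    {ψ : ∀ n, C n →ₗ[K] C n} {ψ' : ∀ n, C' n →ₗ[K] C' n}
    (hψ : ∀ n, ψ' n ∘ₗ S n = S n ∘ₗ ψ n) :
    ∀ n, pairMap ψ' n ∘ₗ pairMap S n = pairMap S n ∘ₗ pairMap ψ n
  | 0 => rfl
  | 1 => hψ 1
  | n + 2 => LinearMap.ext fun x => Prod.ext (LinearMap.congr_fun (hψ (n + 2)) x.1)
      (LinearMap.congr_fun (hψ (n + 1)) x.2)

theorem map_mem_cocycles {D : ∀ n, C n →ₗ[K] C (n + 1)} {D' : ∀ n, C' n →ₗ[K] C' (n + 1)}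
    {S : ∀ n, C n →ₗ[K] C' n} (h : ∀ n, D' n ∘ₗ S n = S (n + 1) ∘ₗ D n) (n : ℕ) (z : C n)
    (hz : z ∈ cocycles D n) : S n z ∈ cocycles D' n := by
  have hz' : D n z = 0 := hz
  refine (LinearMap.congr_fun (h n) z).trans ?_
  simp [hz']

theorem map_mem_coboundaries {D : ∀ n, C n →ₗ[K] C (n + 1)} {D' : ∀ n, C' n →ₗ[K] C' (n + 1)}
    {S : ∀ n, C n →ₗ[K] C' n} (h : ∀ n, D' n ∘ₗ S n = S (n + 1) ∘ₗ D n) :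
    ∀ (n : ℕ) (z : C n), z ∈ coboundaries D n → S n z ∈ coboundaries D' n
  | 0, z, hz => by
    have hz' : z = 0 := hz
    rw [hz', map_zero]
    exact zero_mem _
  | n + 1, z, hz => by
    obtain ⟨y, rfl⟩ := hz
    exact ⟨S n y, LinearMap.congr_fun (h n) y⟩

/-- A cochain map induces a unique linear map in cohomology. -/
theorem existsUnique_cohomology_map {D : ∀ n, C n →ₗ[K] C (n + 1)}
    {D' : ∀ n, C' n →ₗ[K] C' (n + 1)} {S : ∀ n, C n →ₗ[K] C' n}
    (h : ∀ n, D' n ∘ₗ S n = S (n + 1) ∘ₗ D n) (n : ℕ) :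
    ∃! Φ : Cohomology D n →ₗ[K] Cohomology D' n, ∀ z : cocycles D n,
      Φ (cohomologyClass D n z) =
        cohomologyClass D' n ⟨S n z, map_mem_cocycles h n z z.2⟩ := by
  refine ⟨Submodule.mapQ _ _ ((S n).restrict (map_mem_cocycles h n)) fun z hz =>
    map_mem_coboundaries h n z hz, fun z => rfl, fun Φ hΦ => ?_⟩
  -- Linear maps out of a quotient agree once they agree on classes, which gives uniqueness.
  ext z
  exact hΦ z

end Pairs

/-! ### The commutator pair and its representation. -/

section Commutator

variable {K : Type*} [Field K] {κ : K} {A M : Type*} [AddCommGroup A] [Module K A]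
  [AddCommGroup M] [Module K M]

/-- Together with the next lemma, this lets `skew_hochD` apply to `δ_R`: the structures induced by
`R` and `R_M` depend linearly on the products and actions, so antisymmetrizing before or after
inducing gives the same result. -/
theorem commutator_bracketR (P : AssDerPair κ A) :
    P.commutator.bracketR = P.mulR - P.mulR.flip := by
  ext x y
  simp [LieDerPair.bracketR, AssDerPair.mulR, AssDerPair.commutator]
  abel

theorem commutatorRep_ρR {P : AssDerPair κ A} (N : AssBimodule P M) :
    N.commutatorRep.ρR = N.lR - N.rR.flip := by
  ext x m
  simp [LieRep.ρR, AssBimodule.lR, AssBimodule.rR, AssBimodule.commutatorRep,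
    AssDerPair.commutator]
  abel

theorem partialD_comp_skew {P : AssDerPair κ A} (N : AssBimodule P M) (n : ℕ) :
    N.commutatorRep.partialD n ∘ₗ pairMap skew n = pairMap skew (n + 1) ∘ₗ N.partialD n := by
  refine pairD_comp_pairMap skew (fun n => ?_) (fun n => ?_) (fun n => ?_) n
  · exact LinearMap.ext fun f => skew_hochD P.mul N.l N.r _ _ _ rfl rfl n f
  -- The same identity for the induced product and actions; the minus sign of `-δ_R` is removed by
  -- linearity.
  · refine LinearMap.ext fun f => ?_
    have := skew_hochD P.mulR N.lR N.rR _ P.commutator.bracketR_self _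
      (commutator_bracketR P) (commutatorRep_ρR N) n f
    simpa using this
  · refine LinearMap.ext fun f => ?_
    have := skew_phiHoch κ P.R N.RM n f
    simpa [AssBimodule.commutatorRep, AssDerPair.commutator] using this

theorem delta_comp_skew {P : AssDerPair κ A} (N : AssBimodule P M) (n : ℕ) :
    N.commutatorRep.delta n ∘ₗ pairMap skew n = pairMap skew n ∘ₗ N.delta n :=
  pairMap_comp_pairMap_comm skew
    (fun n => LinearMap.ext fun f => skew_deltaHoch P.d N.dM n f) n

theorem D_comp_skewMap {P : AssDerPair κ A} (N : AssBimodule P M) (n : ℕ) :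
    N.commutatorRep.D n ∘ₗ skewMap K A M n = skewMap K A M (n + 1) ∘ₗ N.D n :=
  pairD_comp_pairMap (pairMap skew) (fun n => partialD_comp_skew N (n + 1))
    (fun n => partialD_comp_skew N (n + 1))
    (fun n => by rw [LinearMap.smul_comp, LinearMap.comp_smul, delta_comp_skew]) n

end Commutator

end ModifiedRB

/-- The index `n` also takes the value `0`, where the cochain spaces are zero. Consequently the
coboundaries in degree `1`, the range of the zero map, vanish as required. -/
theorem mainTheorem6 {K : Type*} [Field K] {κ : K} {A : Type*} [AddCommGroup A] [Module K A]
    {M : Type*} [AddCommGroup M] [Module K M] (P : ModifiedRB.AssDerPair κ A)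
    (N : ModifiedRB.AssBimodule P M) :
    (∀ n, N.commutatorRep.D n ∘ₗ ModifiedRB.skewMap K A M n =
      ModifiedRB.skewMap K A M (n + 1) ∘ₗ N.D n) ∧
    ∃ hS : ∀ n, ∀ z ∈ ModifiedRB.cocycles N.D n,
        ModifiedRB.skewMap K A M n z ∈ ModifiedRB.cocycles N.commutatorRep.D n,
      ∀ n, ∃! Φ : ModifiedRB.Cohomology N.D n →ₗ[K] ModifiedRB.Cohomology N.commutatorRep.D n,
        ∀ z : ModifiedRB.cocycles N.D n,
          Φ (ModifiedRB.cohomologyClass N.D n z) =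
            ModifiedRB.cohomologyClass N.commutatorRep.D n
              ⟨ModifiedRB.skewMap K A M n z, hS n z z.2⟩ :=
  ⟨ModifiedRB.D_comp_skewMap N, ModifiedRB.map_mem_cocycles (ModifiedRB.D_comp_skewMap N),
    ModifiedRB.existsUnique_cohomology_map (ModifiedRB.D_comp_skewMap N)⟩
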